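/- Let $H_n$ ($n\ge 0$) be the Hermite polynomials, $H_0=1$, $H_{n+1}(x)=2xH_n(x)-H_n'(x)$, and put $\tilde H_n=H_n/(2^n n!)$ for $n\ge 0$ and $\tilde H_n=0$ for $n<0$. Let $K$ be a positive integer and let $\gamma_0,\dots,\gamma_K$ be real numbers with $\gamma_0=1$ and $\gamma_K\neq 0$. Define $$q_n(x)=\sum_{j=0}^K\gamma_j\tilde H_{n-j}(x)\quad(n\ge 0),\qquad P(x)=\sum_{j=0}^K\gamma_jx^{K-j},$$ and let $N^{nr}$ be the number of non-real zeros of $P$. Numbers of zeros are counted with multiplicity. For finite sets $U,V$ of real numbers, say that $U$ interlaces $V$ if $\min U<\min V$ (with $\min\emptyset=+\infty$) and strictly between any two consecutive elements of either set there is an element of the other. Then: 1. The polynomial $q_n$ has only real zeros for every $n\ge 0$ if and only if $N^{nr}=0$. Moreover, if $N^{nr}=0$, then for every $n\ge 0$ the zeros of $q_n$ are simple and the zeros of $q_{n+1}$ interlace the zeros of $q_n$. 2. If $N^{nr}>0$, then there is a smallest nonnegative integer $n_0$ such that $q_{n_0}$ has exactly $N^{nr}$ non-real zeros. For this $n_0$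 and every $n\ge 0$, the polynomial $q_n$ has exactly $n-N^{nr}$ real zeros and exactly $N^{nr}$ non-real zeros if and only if $n\ge n_0$. Moreover, for every $n\ge n_0$ the real zeros of $q_n$ are simple and the real zeros of $q_{n+1}$ interlace the real zeros of $q_n$. -/

import Mathlib

open Polynomial

namespace HermiteAppell

/-- The physicists' Hermite polynomials `H_n`, as real polynomials:
`H_0 = 1`, `H_{n+1} = 2 x H_n - H_n'`. -/
noncomputable def physHermite : ℕ → ℝ[X]
  | 0 => 1
  | n + 1 => C 2 * X * physHermite n - derivative (physHermite n)

/-- The Appell normalization `H_n / (2 ^ n * n!)`. -/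
noncomputable def normHermite (n : ℕ) : ℝ[X] :=
  C ((2 : ℝ) ^ n * (n.factorial : ℝ))⁻¹ * physHermite n

/-- `q_n = ∑_{j=0}^K γ_j H_{n-j} / (2^{n-j} (n-j)!)`, where the terms with `n - j < 0` are zero. -/
noncomputable def q (K : ℕ) (γ : ℕ → ℝ) (n : ℕ) : ℝ[X] :=
  ∑ j ∈ Finset.range (K + 1), if j ≤ n then C (γ j) * normHermite (n - j) else 0

/-- `P(x) = ∑_{j=0}^K γ_j x^{K-j}`. -/
noncomputable def P (K : ℕ) (γ : ℕ → ℝ) : ℝ[X] :=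
  ∑ j ∈ Finset.range (K + 1), C (γ j) * X ^ (K - j)

/-- The number of non-real complex zeros of a real polynomial, counted with multiplicity. -/
noncomputable def nonRealZeroCount (p : ℝ[X]) : ℕ :=
  (p.map (algebraMap ℝ ℂ)).roots.countP (fun z => z.im ≠ 0)

/-- The number of real zeros of a real polynomial, counted with multiplicity. -/
noncomputable def realZeroCount (p : ℝ[X]) : ℕ := Multiset.card p.roots

/-- All complex zeros of the real polynomial `p` are real. -/
def OnlyRealZeros (p : ℝ[X]) : Prop := ∀ z : ℂ, aeval z p = 0 → z.im = 0

/-- Every real zero of `p` is simple. -/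
def SimpleRealZeros (p : ℝ[X]) : Prop := ∀ x : ℝ, p.IsRoot x → p.rootMultiplicity x = 1

/-- The finite set of real zeros of `p`. -/
noncomputable def realZeros (p : ℝ[X]) : Finset ℝ := p.roots.toFinset

/-- `a < b` are consecutive elements of the finite set `S`. -/
def Consecutive (S : Finset ℝ) (a b : ℝ) : Prop :=
  a ∈ S ∧ b ∈ S ∧ a < b ∧ ∀ c ∈ S, ¬ (a < c ∧ c < b)

/-- `U` strictly interlaces `V`: `min U < min V` (with `min ∅ = +∞`), and strictly between any two
consecutive elements of either set there is an element of the other. -/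
def Interlaces (U V : Finset ℝ) : Prop :=
  (∃ u ∈ U, ∀ v ∈ V, u < v) ∧
  (∀ a b : ℝ, Consecutive U a b → ∃ v ∈ V, a < v ∧ v < b) ∧
  (∀ a b : ℝ, Consecutive V a b → ∃ u ∈ U, a < u ∧ u < b)

end HermiteAppell

namespace HermiteAppell

/-! Put S(t) = ∑ γ_j t^j and D = d/dx. As D lowers the index of the normalized Hermite polynomials,
q_n = S(D) H̃_n, which is `appell S n`, and q_{n+1}' = q_n. The zeros of S are the reciprocals of
those of P, so S too has N non-real zeros. Let c_n be the number of non-real zeros of q_n. By Rolle,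
c_n is nondecreasing. It is at most N (`nonRealZeroCount_appell_le`): a real factor X - a of S acts
as D - a, and the remaining factor, of degree N without real zeros, gives for n ≥ N a polynomial
obtained from one of degree at most N by n - N applications of 2x - D. Neither operator creates
non-real zeros. The bound is attained: n! (t/n)^n q_n(n/t) tends to S(t) exp(-t²/4) uniformly on
bounded sets, so Hurwitz gives c_n ≥ N for large n (`eventually_nonRealZeroCount_le_appell`). Hence
c_n equals N exactly from some n₀ on. Once c_n is constant, the Rolle count is sharp, so a multiple
real zero x of q_n stays a zero of every later q_m. Then the generating function S(t) exp(xt - t²/4)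
of the q_m(x) would be a polynomial in t, which is absurd (`exists_not_isRoot_appell`). Simplicity,
Rolle and counting give the interlacing. -/

/-! ### Rolle's theorem with an exponential weight. -/

/-- The polynomial factor `p' + S' p` of the derivative of `exp(S) p`. -/
noncomputable def twistedDerivative (S p : ℝ[X]) : ℝ[X] := derivative p + derivative S * p

lemma exists_isRoot_twistedDerivative (S p : ℝ[X]) {x y : ℝ} (hxy : x < y)
    (hx : p.IsRoot x) (hy : p.IsRoot y) :
    ∃ z, x < z ∧ z < y ∧ (twistedDerivative S p).IsRoot z := by
  have hd : ∀ t : ℝ, HasDerivAt (fun t => Real.exp (S.eval t) * p.eval t)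
      (Real.exp (S.eval t) * (twistedDerivative S p).eval t) t := by
    intro t
    have h := ((S.hasDerivAt t).exp).mul (p.hasDerivAt t)
    refine h.congr_deriv ?_
    simp only [twistedDerivative, eval_add, eval_mul]
    ring
  obtain ⟨z, hz, hz0⟩ := exists_hasDerivAt_eq_zero hxy
    (fun t _ => (hd t).continuousAt.continuousWithinAt)
    (by simp [hx.eq_zero, hy.eq_zero]) (fun t _ => hd t)
  exact ⟨z, hz.1, hz.2, by simpa [Real.exp_ne_zero] using hz0⟩

lemma rootMultiplicity_sub_one_le_twistedDerivative (S p : ℝ[X]) (hg : twistedDerivative S p ≠ 0)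
    (x : ℝ) : p.rootMultiplicity x - 1 ≤ (twistedDerivative S p).rootMultiplicity x := by
  rw [le_rootMultiplicity_iff hg]
  have h : (X - C x) ^ p.rootMultiplicity x ∣ p := pow_rootMultiplicity_dvd p x
  exact dvd_add (pow_sub_one_dvd_derivative_of_pow_dvd h)
    (((pow_dvd_pow _ (Nat.sub_le _ _)).trans h).mul_left _)

/-- The roots of `g` outside `p`, with multiplicity, are few if `g` inherits from every root of `p`
a root whose multiplicity is smaller by at most one. -/
lemma card_roots_add_sum_le {p g : ℝ[X]}
    (hm : ∀ x, p.rootMultiplicity x - 1 ≤ g.rootMultiplicity x) :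
    Multiset.card p.roots + ∑ x ∈ g.roots.toFinset \ p.roots.toFinset, g.rootMultiplicity x ≤
      Multiset.card g.roots + p.roots.toFinset.card := by
  have h1 : Multiset.card p.roots ≤
      ∑ x ∈ p.roots.toFinset, g.rootMultiplicity x + p.roots.toFinset.card := by
    rw [← Multiset.toFinset_sum_count_eq, Finset.card_eq_sum_ones, ← Finset.sum_add_distrib]
    refine Finset.sum_le_sum fun x _ => ?_
    rw [count_roots]
    have := hm x
    omega
  have h2 : Multiset.card g.roots = ∑ x ∈ p.roots.toFinset, g.rootMultiplicity x +
      ∑ x ∈ g.roots.toFinset \ p.roots.toFinset, g.rootMultiplicity x := by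
    rw [← Finset.sum_union Finset.disjoint_sdiff, Finset.union_sdiff_self_eq_union,
      ← Multiset.toFinset_sum_count_eq]
    simp only [count_roots]
    refine Finset.sum_subset Finset.subset_union_right fun x _ hx => ?_
    rw [← count_roots]
    simpa only [Multiset.mem_toFinset, Multiset.count_eq_zero] using hx
  omega

lemma card_le_sum_rootMultiplicity {g : ℝ[X]} {T : Finset ℝ} (hT : T ⊆ g.roots.toFinset) :
    T.card ≤ ∑ x ∈ T, g.rootMultiplicity x := by
  rw [Finset.card_eq_sum_ones]
  refine Finset.sum_le_sum fun x hx => ?_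
  rw [← count_roots, Nat.succ_le_iff, Multiset.count_pos, ← Multiset.mem_toFinset]
  exact hT hx

lemma card_toFinset_roots_le_twistedDerivative (S : ℝ[X]) {p : ℝ[X]} (hp : p ≠ 0)
    (hg : twistedDerivative S p ≠ 0) :
    p.roots.toFinset.card ≤
      ((twistedDerivative S p).roots.toFinset \ p.roots.toFinset).card + 1 := by
  refine Finset.card_le_sdiff_of_interleaved fun x hx y hy hxy _ => ?_
  rw [Multiset.mem_toFinset, mem_roots hp] at hx hy
  obtain ⟨z, hz1, hz2, hz⟩ := exists_isRoot_twistedDerivative S p hxy hx hy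
  exact ⟨z, by rwa [Multiset.mem_toFinset, mem_roots hg], hz1, hz2⟩

/-- Each zero of `p` keeps all but one of its multiplicity, and Rolle supplies a new zero in every
gap, so at most one zero is lost. -/
lemma card_roots_le_twistedDerivative (S : ℝ[X]) {p : ℝ[X]} (hp : p ≠ 0)
    (hg : twistedDerivative S p ≠ 0) :
    Multiset.card p.roots ≤ Multiset.card (twistedDerivative S p).roots + 1 := by
  have h1 := card_roots_add_sum_le (rootMultiplicity_sub_one_le_twistedDerivative S p hg)
  have h2 := card_toFinset_roots_le_twistedDerivative S hp hg
  have h3 := card_le_sum_rootMultiplicity (g := twistedDerivative S p)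
    (T := (twistedDerivative S p).roots.toFinset \ p.roots.toFinset) Finset.sdiff_subset
  omega

/-- A zero beyond all zeros of `p` pays for the one that Rolle loses. -/
lemma card_roots_le_twistedDerivative_of_gt (S : ℝ[X]) {p : ℝ[X]} (hp : p ≠ 0)
    (hg : twistedDerivative S p ≠ 0) {c : ℝ} (hc : ∀ x, p.IsRoot x → x < c)
    (hgc : (twistedDerivative S p).IsRoot c) :
    Multiset.card p.roots ≤ Multiset.card (twistedDerivative S p).roots := by
  have h1 := card_roots_add_sum_le (rootMultiplicity_sub_one_le_twistedDerivative S p hg)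
  set T := (twistedDerivative S p).roots.toFinset \ p.roots.toFinset with hT
  have hcT : c ∈ T := by
    rw [hT, Finset.mem_sdiff, Multiset.mem_toFinset, Multiset.mem_toFinset, mem_roots hg,
      mem_roots hp]
    exact ⟨hgc, fun h => lt_irrefl _ (hc c h)⟩
  -- The Rolle zeros lie between zeros of `p`, hence below `c`, and survive its removal.
  have h2 : p.roots.toFinset.card ≤ (T.erase c).card + 1 := by
    have : T.erase c = ((twistedDerivative S p).roots.toFinset.erase c) \ p.roots.toFinset := by
      ext x
      simp only [hT, Finset.mem_erase, Finset.mem_sdiff]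
      tauto
    rw [this]
    refine Finset.card_le_sdiff_of_interleaved fun x hx y hy hxy _ => ?_
    rw [Multiset.mem_toFinset, mem_roots hp] at hx hy
    obtain ⟨z, hz1, hz2, hz⟩ := exists_isRoot_twistedDerivative S p hxy hx hy
    refine ⟨z, ?_, hz1, hz2⟩
    rw [Finset.mem_erase, Multiset.mem_toFinset, mem_roots hg]
    exact ⟨(hz2.trans (hc y hy)).ne, hz⟩
  have h3 := card_le_sum_rootMultiplicity (g := twistedDerivative S p) (T := T)
    Finset.sdiff_subset
  have h4 := Finset.card_erase_add_one hcT
  omega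

/-! ### Counting non-real zeros -/

lemma countP_im_eq_zero_roots_map (p : ℝ[X]) :
    (p.map (algebraMap ℝ ℂ)).roots.countP (fun z => z.im = 0) = Multiset.card p.roots := by
  rw [Multiset.countP_eq_card_filter]
  have : (p.map (algebraMap ℝ ℂ)).roots.filter (fun z => z.im = 0) =
      p.roots.map (algebraMap ℝ ℂ) := by
    ext z
    rw [Multiset.count_filter]
    split_ifs with hz
    · obtain ⟨x, rfl⟩ : ∃ x : ℝ, algebraMap ℝ ℂ x = z := ⟨z.re, by
        apply Complex.ext <;> simp [hz]⟩
      rw [count_roots, ← eq_rootMultiplicity_map (algebraMap ℝ ℂ).injective,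
        Multiset.count_map_eq_count' _ _ (algebraMap ℝ ℂ).injective, count_roots]
    · symm
      rw [Multiset.count_eq_zero, Multiset.mem_map]
      rintro ⟨x, -, rfl⟩
      simp at hz
  rw [this, Multiset.card_map]

lemma realZeroCount_add_nonRealZeroCount (p : ℝ[X]) :
    realZeroCount p + nonRealZeroCount p = p.natDegree := by
  rw [realZeroCount, nonRealZeroCount, ← countP_im_eq_zero_roots_map,
    ← Multiset.card_eq_countP_add_countP]
  rw [← natDegree_map_eq_of_injective (algebraMap ℝ ℂ).injective p]
  exact (IsAlgClosed.splits _).natDegree_eq_card_roots.symm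

/-- Complex conjugation permutes the zeros and exchanges the two half planes. Parity later turns "at
most one more non-real zero" into "no more". -/
lemma even_nonRealZeroCount (p : ℝ[X]) : Even (nonRealZeroCount p) := by
  set s := (p.map (algebraMap ℝ ℂ)).roots with hs
  have hconj : s.map (starRingEnd ℂ) = s := by
    rw [hs, Polynomial.roots_map_of_injective_of_card_eq_natDegree (starRingEnd ℂ).injective
      (IsAlgClosed.splits _).natDegree_eq_card_roots.symm, Polynomial.map_map]
    congr 2
    ext x
    simp
  have h1 : s.countP (fun z => 0 < z.im) = s.countP (fun z => z.im < 0) := by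
    conv_lhs => rw [← hconj]
    rw [Multiset.countP_map, Multiset.countP_eq_card_filter]
    simp
  have h2 : s.countP (fun z => z.im ≠ 0) =
      s.countP (fun z => 0 < z.im) + s.countP (fun z => z.im < 0) := by
    clear h1 hconj hs
    induction s using Multiset.induction_on with
    | empty => simp
    | cons a s ih =>
      simp only [Multiset.countP_cons, ih]
      rcases lt_trichotomy a.im 0 with h | h | h
      · simp [h, h.ne, h.not_gt]; omega
      · simp [h]
      · simp [h, h.ne', h.not_gt]; omega
  rw [nonRealZeroCount, ← hs, h2, h1]
  exact ⟨_, rfl⟩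

/-! ### Operators that create no non-real zeros: D, D - a and 2x - D. -/

lemma nonRealZeroCount_derivative_le (p : ℝ[X]) :
    nonRealZeroCount (derivative p) ≤ nonRealZeroCount p := by
  have h1 := realZeroCount_add_nonRealZeroCount p
  have h2 := realZeroCount_add_nonRealZeroCount (derivative p)
  have h3 := card_roots_le_derivative p
  have h4 := natDegree_derivative_le p
  by_cases h0 : p.natDegree = 0
  · omega
  · unfold realZeroCount at h1 h2
    omega

lemma natDegree_derivative_sub_C_mul {a : ℝ} (ha : a ≠ 0) {p : ℝ[X]} (hp : p ≠ 0) :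
    derivative p - C a * p ≠ 0 ∧ (derivative p - C a * p).natDegree = p.natDegree := by
  have hd : (derivative p - C a * p).degree = p.degree := by
    rw [degree_sub_eq_right_of_degree_lt, degree_C_mul ha]
    rw [degree_C_mul ha]
    exact degree_derivative_lt hp
  refine ⟨fun h => hp ?_, natDegree_eq_of_degree_eq hd⟩
  rw [← degree_eq_bot, ← hd, h, degree_zero]

/-- Rolle for exp(-ax) p loses at most one real zero while the degree is unchanged; parity excludes
a gain of one non-real zero. -/
lemma nonRealZeroCount_derivative_sub_C_mul_le {a : ℝ} (ha : a ≠ 0) {p : ℝ[X]} (hp : p ≠ 0) :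
    nonRealZeroCount (derivative p - C a * p) ≤ nonRealZeroCount p := by
  obtain ⟨hg, hdeg⟩ := natDegree_derivative_sub_C_mul ha hp
  have htw : twistedDerivative (-(C a * X)) p = derivative p - C a * p := by
    simp [twistedDerivative, sub_eq_add_neg]
  have h1 := realZeroCount_add_nonRealZeroCount p
  have h2 := realZeroCount_add_nonRealZeroCount (derivative p - C a * p)
  have h3 := card_roots_le_twistedDerivative (-(C a * X)) hp (htw ▸ hg)
  rw [htw] at h3
  obtain ⟨u, hu⟩ := even_nonRealZeroCount p
  obtain ⟨v, hv⟩ := even_nonRealZeroCount (derivative p - C a * p)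
  unfold realZeroCount at h1 h2
  omega

/-- The raising operator `p ↦ 2 x p - p'` of the Hermite polynomials. -/
noncomputable def raise (p : ℝ[X]) : ℝ[X] := C 2 * X * p - derivative p

lemma degree_derivative_lt_C_two_mul_X_mul {p : ℝ[X]} (hp : p ≠ 0) :
    (derivative p).degree < (C 2 * X * p).degree := by
  refine (degree_derivative_lt hp).trans_le ?_
  rw [degree_mul, degree_C_mul_X two_ne_zero]
  exact le_add_of_nonneg_left zero_le_one

lemma natDegree_raise {p : ℝ[X]} (hp : p ≠ 0) : (raise p).natDegree = p.natDegree + 1 := by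
  rw [raise, natDegree_eq_of_degree_eq
    (degree_sub_eq_left_of_degree_lt (degree_derivative_lt_C_two_mul_X_mul hp)),
    natDegree_mul (by simp) hp, natDegree_C_mul_X _ two_ne_zero, add_comm]

lemma raise_ne_zero {p : ℝ[X]} (hp : p ≠ 0) : raise p ≠ 0 := by
  intro h
  have := natDegree_raise hp
  simp [h] at this

lemma leadingCoeff_raise {p : ℝ[X]} (hp : p ≠ 0) :
    (raise p).leadingCoeff = 2 * p.leadingCoeff := by
  rw [raise, leadingCoeff_sub_of_degree_lt (degree_derivative_lt_C_two_mul_X_mul hp)]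
  simp

lemma raise_neg (p : ℝ[X]) : raise (-p) = -raise p := by
  simp only [raise, derivative_neg]
  ring

lemma exists_eval_pos_of_leadingCoeff_pos {p : ℝ[X]} (h : 0 < p.leadingCoeff) (c : ℝ) :
    ∃ x, c < x ∧ 0 < p.eval x := by
  by_cases hd : 0 < p.degree
  · exact ((Filter.eventually_gt_atTop c).and
      ((tendsto_atTop_of_leadingCoeff_nonneg p hd h.le).eventually_gt_atTop 0)).exists
  · rw [eq_C_of_degree_le_zero (not_lt.1 hd)] at h ⊢
    exact ⟨c + 1, by simp, by simpa using h⟩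

/-- This is Rolle on [c, ∞) for exp(-x²) p. For a positive leading coefficient, the absence of a
zero would make `raise p` positive beyond `c` and the weighted function strictly decreasing from 0,
although `p` is positive somewhere further on. -/
lemma exists_isRoot_raise_gt {p : ℝ[X]} (hp : p ≠ 0) {c : ℝ} (hc : p.IsRoot c) :
    ∃ x, c < x ∧ (raise p).IsRoot x := by
  wlog hpos : 0 < p.leadingCoeff generalizing p
  · have hneg : 0 < (-p).leadingCoeff := by
      rw [leadingCoeff_neg]
      have := leadingCoeff_ne_zero.2 hp
      grind
    obtain ⟨x, hx, hr⟩ := this (neg_ne_zero.2 hp) (by simpa using hc) hneg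
    exact ⟨x, hx, by simpa [raise_neg] using hr⟩
  by_contra! hno
  have hgpos : ∀ x, c < x → 0 < (raise p).eval x := by
    intro x hx
    by_contra! hle
    obtain ⟨y, hy, hy0⟩ := exists_eval_pos_of_leadingCoeff_pos
      (p := raise p) (by rw [leadingCoeff_raise hp]; positivity) x
    obtain ⟨z, hz, hz0⟩ := intermediate_value_Icc hy.le (raise p).continuousOn ⟨hle, hy0.le⟩
    exact hno z (hx.trans_le hz.1) hz0
  have hd : ∀ t : ℝ, HasDerivAt (fun t => Real.exp (-t ^ 2) * p.eval t)
      (-(Real.exp (-t ^ 2) * (raise p).eval t)) t := by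
    intro t
    have h := (((hasDerivAt_pow 2 t).neg).exp).mul (p.hasDerivAt t)
    refine h.congr_deriv ?_
    simp only [raise, eval_sub, eval_mul, eval_C, eval_X]
    norm_num
    ring
  have hanti : StrictAntiOn (fun t => Real.exp (-t ^ 2) * p.eval t) (Set.Ici c) := by
    refine strictAntiOn_of_deriv_neg (convex_Ici c)
      (fun t _ => (hd t).continuousAt.continuousWithinAt) fun t ht => ?_
    rw [interior_Ici] at ht
    rw [(hd t).deriv, neg_lt_zero]
    exact mul_pos (Real.exp_pos _) (hgpos t ht)
  obtain ⟨x, hx, hx0⟩ := exists_eval_pos_of_leadingCoeff_pos hpos c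
  have := hanti (Set.mem_Ici.2 le_rfl) (Set.mem_Ici.2 hx.le) hx
  simp only [hc.eq_zero, mul_zero] at this
  exact absurd this (not_lt.2 (mul_nonneg (Real.exp_pos _).le hx0.le))

/-- The zero beyond the largest zero of `p` keeps the real count from dropping; the degree grows by
one, and parity does the rest. -/
lemma nonRealZeroCount_raise_le {p : ℝ[X]} (hp : p ≠ 0) :
    nonRealZeroCount (raise p) ≤ nonRealZeroCount p := by
  have h1 := realZeroCount_add_nonRealZeroCount p
  have h2 := realZeroCount_add_nonRealZeroCount (raise p)
  have hdeg := natDegree_raise hp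
  have hg := raise_ne_zero hp
  have htw : twistedDerivative (-(X ^ 2)) p = -raise p := by
    simp only [twistedDerivative, raise, derivative_neg, derivative_X_sq]
    ring
  have h3 : Multiset.card p.roots ≤ Multiset.card (raise p).roots := by
    by_cases hr : p.roots = 0
    · simp [hr]
    · have hne : p.roots.toFinset.Nonempty := by
        rwa [Finset.nonempty_iff_ne_empty, Ne, Multiset.toFinset_eq_empty]
      have hmem := Finset.max'_mem _ hne
      rw [Multiset.mem_toFinset, mem_roots hp] at hmem
      obtain ⟨c, hc, hcr⟩ := exists_isRoot_raise_gt hp hmem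
      have h := card_roots_le_twistedDerivative_of_gt (-(X ^ 2)) hp
        (by rw [htw]; exact neg_ne_zero.2 hg) (c := c) (fun x hx => ?_) (by simpa [htw] using hcr)
      · rwa [htw, roots_neg] at h
      · refine lt_of_le_of_lt (Finset.le_max' _ x ?_) hc
        rwa [Multiset.mem_toFinset, mem_roots hp]
  obtain ⟨u, hu⟩ := even_nonRealZeroCount p
  obtain ⟨v, hv⟩ := even_nonRealZeroCount (raise p)
  unfold realZeroCount at h1 h2
  omega

lemma iterate_raise_ne_zero {p : ℝ[X]} (hp : p ≠ 0) (m : ℕ) : raise^[m] p ≠ 0 := by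
  induction m with
  | zero => exact hp
  | succ m ih => rw [Function.iterate_succ_apply']; exact raise_ne_zero ih

lemma nonRealZeroCount_iterate_raise_le {p : ℝ[X]} (hp : p ≠ 0) (m : ℕ) :
    nonRealZeroCount (raise^[m] p) ≤ nonRealZeroCount p := by
  induction m with
  | zero => exact le_rfl
  | succ m ih =>
    rw [Function.iterate_succ_apply']
    exact (nonRealZeroCount_raise_le (iterate_raise_ne_zero hp m)).trans ih

/-! ### Hermite polynomials -/

lemma physHermite_succ (n : ℕ) : physHermite (n + 1) = raise (physHermite n) := rfl

lemma physHermite_eq_iterate_raise (n : ℕ) : physHermite n = raise^[n] 1 := by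
  induction n with
  | zero => rfl
  | succ n ih => rw [Function.iterate_succ_apply', ← ih, physHermite_succ]

lemma natDegree_physHermite (n : ℕ) : (physHermite n).natDegree = n := by
  induction n with
  | zero => simp [physHermite]
  | succ n ih =>
    have h : physHermite n ≠ 0 := by
      rw [physHermite_eq_iterate_raise]; exact iterate_raise_ne_zero one_ne_zero n
    rw [physHermite_succ, natDegree_raise h, ih]

lemma derivative_physHermite_succ (n : ℕ) :
    derivative (physHermite (n + 1)) = C (2 * ((n : ℝ) + 1)) * physHermite n := by
  induction n with
  | zero => simp [physHermite]
  | succ n ih =>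
    have h : derivative (physHermite (n + 2)) = C 2 * physHermite (n + 1) +
        C 2 * X * derivative (physHermite (n + 1)) -
          derivative (derivative (physHermite (n + 1))) := by
      rw [physHermite_succ, raise]
      simp only [derivative_sub, derivative_mul, derivative_C, derivative_X]
      ring
    rw [h, ih, derivative_C_mul]
    have h2 : physHermite (n + 1) = C 2 * X * physHermite n - derivative (physHermite n) := rfl
    have h3 : (C (2 * (((n + 1 : ℕ) : ℝ) + 1)) : ℝ[X]) = C 2 + C (2 * ((n : ℝ) + 1)) := by
      rw [← C_add]; congr 1; push_cast; ring
    rw [h3, h2]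
    ring

lemma normHermite_zero : normHermite 0 = 1 := by simp [normHermite, physHermite]

lemma derivative_normHermite_succ (n : ℕ) :
    derivative (normHermite (n + 1)) = normHermite n := by
  rw [normHermite, derivative_C_mul, derivative_physHermite_succ, normHermite, ← mul_assoc, ← C_mul]
  congr 2
  rw [Nat.factorial_succ]
  push_cast
  have : (n.factorial : ℝ) ≠ 0 := by positivity
  field_simp
  ring

lemma normHermite_one : normHermite 1 = X := by
  have h : (C (2⁻¹ : ℝ) * C 2 : ℝ[X]) = 1 := by rw [← C_mul]; norm_num
  simp only [normHermite, physHermite]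
  simp [← mul_assoc, h]

lemma normHermite_three_term (n : ℕ) :
    C ((n : ℝ) + 2) * normHermite (n + 2) = X * normHermite (n + 1) - C 2⁻¹ * normHermite n := by
  have h : normHermite (n + 2) = C ((2 : ℝ) ^ (n + 2) * ((n + 2).factorial : ℝ))⁻¹ *
      (C 2 * X * physHermite (n + 1) - C (2 * ((n : ℝ) + 1)) * physHermite n) := by
    rw [← derivative_physHermite_succ]; rfl
  have hf : (n.factorial : ℝ) ≠ 0 := by positivity
  have e1 : ((n : ℝ) + 2) * ((2 : ℝ) ^ (n + 2) * ((n + 2).factorial : ℝ))⁻¹ * 2 =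
      ((2 : ℝ) ^ (n + 1) * ((n + 1).factorial : ℝ))⁻¹ := by
    simp only [Nat.factorial_succ]; push_cast; field_simp; ring
  have e2 : ((n : ℝ) + 2) * ((2 : ℝ) ^ (n + 2) * ((n + 2).factorial : ℝ))⁻¹ *
      (2 * ((n : ℝ) + 1)) = 2⁻¹ * ((2 : ℝ) ^ n * (n.factorial : ℝ))⁻¹ := by
    simp only [Nat.factorial_succ]; push_cast; field_simp; ring
  rw [h, normHermite, normHermite, ← e1, ← mul_assoc (C 2⁻¹), ← C_mul, ← e2]
  simp only [C_mul]
  ring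

lemma derivative_pow_normHermite (n j : ℕ) :
    ((derivative : ℝ[X] →ₗ[ℝ] ℝ[X]) ^ j) (normHermite n) =
      if j ≤ n then normHermite (n - j) else 0 := by
  induction j with
  | zero => simp
  | succ j ih =>
    rw [pow_succ', Module.End.mul_apply, ih]
    split_ifs with h1 h2 h2
    · obtain ⟨m, rfl⟩ := Nat.exists_eq_add_of_lt h2
      rw [show j + m + 1 - j = m + 1 by omega, show j + m + 1 - (j + 1) = m by omega,
        derivative_normHermite_succ]
    · rw [show n - j = 0 by omega, normHermite_zero, derivative_one]
    · omega
    · exact derivative_zero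

/-! ### Differential operators applied to Hermite polynomials -/

/-- The Appell sequence `S(d/dx) H_n / (2 ^ n n!)`. -/
noncomputable def appell (S : ℝ[X]) (n : ℕ) : ℝ[X] :=
  aeval (derivative : ℝ[X] →ₗ[ℝ] ℝ[X]) S (normHermite n)

lemma appell_eq_sum {S : ℝ[X]} {k : ℕ} (hS : S.natDegree < k) (n : ℕ) :
    appell S n = ∑ i ∈ Finset.range k,
      if i ≤ n then C (S.coeff i) * normHermite (n - i) else 0 := by
  rw [appell, aeval_eq_sum_range' hS, LinearMap.sum_apply]
  refine Finset.sum_congr rfl fun i _ => ?_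
  rw [LinearMap.smul_apply, derivative_pow_normHermite, smul_eq_C_mul]
  split_ifs <;> simp

lemma appell_eq_sum_range (S : ℝ[X]) (n : ℕ) :
    appell S n = ∑ i ∈ Finset.range (n + 1), C (S.coeff i) * normHermite (n - i) := by
  rw [appell_eq_sum (k := S.natDegree + n + 1) (by omega), ← Finset.sum_filter]
  congr 1
  ext i
  simp
  omega

lemma appell_X_sub_C_mul (a : ℝ) (S : ℝ[X]) (n : ℕ) :
    appell ((X - C a) * S) n = derivative (appell S n) - C a * appell S n := by
  simp only [appell, map_mul, Module.End.mul_apply, map_sub, aeval_X, aeval_C, LinearMap.sub_apply,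
    Module.algebraMap_end_apply, smul_eq_C_mul]

lemma derivative_appell_succ (S : ℝ[X]) (n : ℕ) :
    derivative (appell S (n + 1)) = appell S n := by
  rw [appell, ← Module.End.mul_apply]
  have : Commute (derivative : Module.End ℝ ℝ[X]) (aeval (derivative : ℝ[X] →ₗ[ℝ] ℝ[X]) S) := by
    have h := (Commute.all (X : ℝ[X]) S).map (aeval (derivative : ℝ[X] →ₗ[ℝ] ℝ[X]))
    rwa [aeval_X] at h
  rw [this.eq, Module.End.mul_apply, derivative_normHermite_succ, appell]

lemma appell_zero (S : ℝ[X]) : appell S 0 = C (S.coeff 0) := by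
  simp [appell_eq_sum_range, normHermite_zero]

/-- This is Taylor's formula at 0, since m differentiations of `appell S n` give `appell S (n - m)`.
-/
lemma coeff_appell (S : ℝ[X]) (n m : ℕ) :
    (appell S n).coeff m =
      if m ≤ n then (appell S (n - m)).coeff 0 / (m.factorial : ℝ) else 0 := by
  induction m generalizing n with
  | zero => simp
  | succ m ih =>
    cases n with
    | zero => simp [appell_zero]
    | succ n =>
      have h := ih n
      rw [← derivative_appell_succ, coeff_derivative] at h
      have hm : ((m : ℝ) + 1) ≠ 0 := by positivity
      rw [← mul_left_inj' hm, h]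
      simp only [Nat.add_le_add_iff_right, Nat.add_sub_add_right]
      split_ifs
      · rw [Nat.factorial_succ]
        have : (m.factorial : ℝ) ≠ 0 := by positivity
        push_cast
        field_simp
      · simp

lemma coeff_appell_self (S : ℝ[X]) (n : ℕ) :
    (appell S n).coeff n = S.coeff 0 / (n.factorial : ℝ) := by
  rw [coeff_appell]
  simp [appell_zero]

lemma natDegree_appell {S : ℝ[X]} (hS : S.coeff 0 ≠ 0) (n : ℕ) :
    (appell S n).natDegree = n := by
  refine natDegree_eq_of_le_of_coeff_ne_zero ?_ ?_
  · rw [natDegree_le_iff_coeff_eq_zero]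
    intro m hm
    rw [coeff_appell, if_neg (not_le.2 hm)]
  · rw [coeff_appell_self]
    positivity

lemma appell_ne_zero {S : ℝ[X]} (hS : S.coeff 0 ≠ 0) (n : ℕ) : appell S n ≠ 0 := by
  intro h
  have := coeff_appell_self S n
  rw [h, coeff_zero] at this
  exact (div_ne_zero hS (by positivity)) this.symm

lemma nonRealZeroCount_appell_mono (S : ℝ[X]) :
    Monotone fun n => nonRealZeroCount (appell S n) :=
  monotone_nat_of_le_succ fun n => by
    rw [← derivative_appell_succ]; exact nonRealZeroCount_derivative_le _

/-! ### The upper bound -/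

lemma raise_sum (s : Finset ℕ) (c : ℕ → ℝ) (f : ℕ → ℝ[X]) :
    raise (∑ i ∈ s, C (c i) * f i) = ∑ i ∈ s, C (c i) * raise (f i) := by
  simp only [raise, derivative_sum, derivative_C_mul, Finset.mul_sum, ← Finset.sum_sub_distrib]
  exact Finset.sum_congr rfl fun i _ => by ring

lemma iterate_raise_sum (s : Finset ℕ) (c : ℕ → ℝ) (f : ℕ → ℝ[X]) (m : ℕ) :
    raise^[m] (∑ i ∈ s, C (c i) * f i) = ∑ i ∈ s, C (c i) * raise^[m] (f i) := by
  induction m with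
  | zero => rfl
  | succ m ih => simp only [Function.iterate_succ_apply', ih, raise_sum]

lemma nonRealZeroCount_le_natDegree (p : ℝ[X]) : nonRealZeroCount p ≤ p.natDegree := by
  have := realZeroCount_add_nonRealZeroCount p
  omega

/-- For n ≥ k every Hermite polynomial involved is the (n - k)-fold raising of one of degree at most
k, so the raising factors out. The remaining `r` depends on n, but only its degree matters. -/
lemma nonRealZeroCount_appell_le_natDegree {S : ℝ[X]} (hS : S.coeff 0 ≠ 0) (n : ℕ) :
    nonRealZeroCount (appell S n) ≤ S.natDegree := by
  set k := S.natDegree with hk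
  rcases lt_or_ge n k with hn | hn
  · exact (nonRealZeroCount_le_natDegree _).trans (by rw [natDegree_appell hS]; exact hn.le)
  set r : ℝ[X] := ∑ i ∈ Finset.range (k + 1),
    C (S.coeff i * ((2 : ℝ) ^ (n - i) * ((n - i).factorial : ℝ))⁻¹) * physHermite (k - i) with hr
  have h1 : appell S n = raise^[n - k] r := by
    rw [appell_eq_sum (k := k + 1) (by omega), hr, iterate_raise_sum]
    refine Finset.sum_congr rfl fun i hi => ?_
    rw [Finset.mem_range] at hi
    rw [if_pos (by omega), normHermite, C_mul, mul_assoc, physHermite_eq_iterate_raise (k - i),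
      ← Function.iterate_add_apply, physHermite_eq_iterate_raise (n - i)]
    congr 4
    omega
  have h2 : r.natDegree ≤ k := by
    refine natDegree_sum_le_of_forall_le _ _ fun i _ => ?_
    refine (natDegree_C_mul_le _ _).trans ?_
    rw [natDegree_physHermite]
    omega
  have h3 : r ≠ 0 := by
    intro h
    have hz : raise^[n - k] (0 : ℝ[X]) = 0 := Function.iterate_fixed (by simp [raise]) _
    rw [h, hz] at h1
    exact appell_ne_zero hS n h1
  rw [h1]
  exact (nonRealZeroCount_iterate_raise_le h3 _).trans ((nonRealZeroCount_le_natDegree r).trans h2)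

/-- Induction on the number of real zeros of `S`; with none left, its non-real count is its degree
and the previous bound is the claim. -/
lemma nonRealZeroCount_appell_le (S : ℝ[X]) (hS : S.coeff 0 ≠ 0) (n : ℕ) :
    nonRealZeroCount (appell S n) ≤ nonRealZeroCount S := by
  obtain ⟨d, hd⟩ : ∃ d, Multiset.card S.roots = d := ⟨_, rfl⟩
  induction d generalizing S with
  | zero =>
    have h1 := realZeroCount_add_nonRealZeroCount S
    have h2 := nonRealZeroCount_appell_le_natDegree hS n
    unfold realZeroCount at h1
    omega
  | succ d ih =>
    have hS0 : S ≠ 0 := fun h => by simp [h] at hS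
    obtain ⟨a, ha⟩ := Multiset.card_pos_iff_exists_mem.1 (by rw [hd]; exact Nat.succ_pos d)
    obtain ⟨T, rfl⟩ := dvd_iff_isRoot.2 ((mem_roots hS0).1 ha)
    have hT0 : T ≠ 0 := right_ne_zero_of_mul hS0
    -- A nonzero constant term keeps a away from 0, so that D - a preserves degrees.
    have hcoeff : -a ≠ 0 ∧ T.coeff 0 ≠ 0 := by simpa [mul_coeff_zero] using hS
    have hr : Multiset.card ((X - C a) * T).roots = Multiset.card T.roots + 1 := by
      rw [roots_mul hS0, roots_X_sub_C, Multiset.card_add, Multiset.card_singleton, add_comm]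
    have hT := ih T hcoeff.2 (by omega)
    have h1 := realZeroCount_add_nonRealZeroCount ((X - C a) * T)
    have h2 := realZeroCount_add_nonRealZeroCount T
    have h3 : ((X - C a) * T).natDegree = T.natDegree + 1 := by
      rw [natDegree_mul (X_sub_C_ne_zero a) hT0, natDegree_X_sub_C, add_comm]
    have h4 := nonRealZeroCount_derivative_sub_C_mul_le (neg_ne_zero.1 hcoeff.1)
      (appell_ne_zero hcoeff.2 n)
    rw [appell_X_sub_C_mul]
    unfold realZeroCount at h1 h2
    omega

/-! ### Stability of the number of non-real zeros under locally uniform limits -/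

/-- Uniform convergence on bounded sets of a sequence of polynomials to a function. -/
def ConvergesOnBounded (f : ℕ → ℂ[X]) (F : ℂ → ℂ) : Prop :=
  ∀ R ε : ℝ, 0 < ε → ∀ᶠ n in Filter.atTop, ∀ t : ℂ, ‖t‖ ≤ R → ‖(f n).eval t - F t‖ ≤ ε

lemma exists_sphere_forall_eval_ne_zero {S : ℂ[X]} (hS : S ≠ 0) (ζ : ℂ) {ε : ℝ} (hε : 0 < ε) :
    ∃ r, 0 < r ∧ r ≤ ε ∧ ∀ z ∈ Metric.sphere ζ r, S.eval z ≠ 0 := by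
  have hfin : ((S.roots.toFinset.erase ζ : Finset ℂ) : Set ℂ)ᶜ ∈ nhds ζ :=
    (Finset.finite_toSet _).isClosed.isOpen_compl.mem_nhds (by simp)
  obtain ⟨δ, hδ, hsub⟩ := Metric.mem_nhds_iff.1 hfin
  refine ⟨min ε (δ / 2), by positivity, min_le_left _ _, fun z hz h0 => ?_⟩
  rw [Metric.mem_sphere] at hz
  have hr : 0 < min ε (δ / 2) := by positivity
  have hlt : dist z ζ < δ := by
    rw [hz]; exact (min_le_right _ _).trans_lt (by linarith)
  refine hsub (Metric.mem_ball.2 hlt) ?_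
  rw [Finset.mem_coe, Finset.mem_erase, Multiset.mem_toFinset, mem_roots hS]
  exact ⟨dist_pos.1 (hz ▸ hr), h0⟩

/-- The existence half of Hurwitz's theorem, from the quantitative open mapping theorem on a small
disc around `ζ`. -/
lemma eventually_exists_root_near {f : ℕ → ℂ[X]} {S : ℂ[X]} {G : ℂ → ℂ} (hS : S ≠ 0)
    (hG : Differentiable ℂ G) (hG0 : ∀ t, G t ≠ 0)
    (hf : ConvergesOnBounded f fun t => S.eval t * G t) {ζ : ℂ} (hζ : S.IsRoot ζ)
    {ε : ℝ} (hε : 0 < ε) :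
    ∀ᶠ n in Filter.atTop, ∃ z, (f n).IsRoot z ∧ ‖z - ζ‖ ≤ ε := by
  obtain ⟨r, hr, hrε, hne⟩ := exists_sphere_forall_eval_ne_zero hS ζ hε
  have hcont : Continuous fun t => ‖S.eval t * G t‖ :=
    (S.continuous.mul hG.continuous).norm
  obtain ⟨w, hw, hwmin⟩ := (isCompact_sphere ζ r).exists_isMinOn
    (NormedSpace.sphere_nonempty.2 hr.le) hcont.continuousOn
  set δ := ‖S.eval w * G w‖ with hδ
  have hδ0 : 0 < δ := norm_pos_iff.2 (mul_ne_zero (hne w hw) (hG0 w))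
  -- With error δ/5, `f n` differs from its central value by at least 3δ/5 on the circle, so its
  -- image contains the disc of radius 3δ/10 about that value, and 0 is within δ/5 of it.
  filter_upwards [hf (‖ζ‖ + r) (δ / 5) (by positivity)] with n hn
  have hcenter : ‖(f n).eval ζ‖ ≤ δ / 5 := by
    have h := hn ζ (by linarith)
    rwa [hζ.eq_zero, zero_mul, sub_zero] at h
  have hsphere : ∀ z ∈ Metric.sphere ζ r, 3 * δ / 5 ≤ ‖(f n).eval z - (f n).eval ζ‖ := by
    intro z hz
    have hzn : ‖z‖ ≤ ‖ζ‖ + r := by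
      have h1 : ‖z - ζ‖ = r := by rwa [Metric.mem_sphere, dist_eq_norm] at hz
      have h2 := norm_add_le ζ (z - ζ)
      rw [add_sub_cancel] at h2
      linarith
    have h1 : δ ≤ ‖S.eval z * G z‖ := hwmin hz
    have h2 := hn z hzn
    have h3 : ‖S.eval z * G z‖ ≤ ‖(f n).eval z - (f n).eval ζ‖ + ‖(f n).eval ζ‖ +
        ‖(f n).eval z - S.eval z * G z‖ := by
      have : S.eval z * G z = ((f n).eval z - (f n).eval ζ) + (f n).eval ζ -
        ((f n).eval z - S.eval z * G z) := by ring
      calc _ = _ := congrArg norm this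
        _ ≤ _ := (norm_sub_le _ _).trans (add_le_add (norm_add_le _ _) le_rfl)
    linarith
  have hnonconst : ∃ᶠ z in nhds ζ, (f n).eval z ≠ (f n).eval ζ := by
    have hg : f n - C ((f n).eval ζ) ≠ 0 := by
      intro h
      have h1 := hsphere w hw
      have h2 : (f n).eval w - (f n).eval ζ = 0 := by
        have := congrArg (eval w) h
        simpa using this
      rw [h2, norm_zero] at h1
      linarith
    rw [Metric.nhds_basis_ball.frequently_iff]
    intro s hs
    obtain ⟨ρ, hρ, hρs, hρne⟩ := exists_sphere_forall_eval_ne_zero hg ζ (half_pos hs)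
    obtain ⟨z, hz⟩ := NormedSpace.sphere_nonempty (x := ζ) |>.2 hρ.le
    refine ⟨z, ?_, fun h => hρne z hz (by simp [h])⟩
    rw [Metric.mem_sphere] at hz
    rw [Metric.mem_ball, hz]
    linarith
  have hsub := DiffContOnCl.ball_subset_image_closedBall
    ((f n).differentiable.diffContOnCl) hr hsphere hnonconst
  obtain ⟨z, hz, hz0⟩ := hsub (a := 0) (by
    rw [Metric.mem_ball, dist_zero_left]; linarith)
  refine ⟨z, hz0, ?_⟩
  rw [Metric.mem_closedBall, dist_eq_norm] at hz
  exact hz.trans hrε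

lemma exists_root_tendsto {f : ℕ → ℂ[X]} {S : ℂ[X]} {G : ℂ → ℂ} (hS : S ≠ 0)
    (hG : Differentiable ℂ G) (hG0 : ∀ t, G t ≠ 0) (hf0 : ∀ᶠ n in Filter.atTop, f n ≠ 0)
    (hf : ConvergesOnBounded f fun t => S.eval t * G t) {ζ : ℂ} (hζ : S.IsRoot ζ) :
    ∃ z : ℕ → ℂ, (∀ᶠ n in Filter.atTop, (f n).IsRoot (z n)) ∧
      Filter.Tendsto z Filter.atTop (nhds ζ) := by
  -- A zero nearest to `ζ` serves all ε at once; if `f n` has no zeros the condition is vacuous.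
  have hmin : ∀ n, ∃ z, ∀ y ∈ (f n).roots, z ∈ (f n).roots ∧ ‖z - ζ‖ ≤ ‖y - ζ‖ := by
    intro n
    rcases (f n).roots.toFinset.eq_empty_or_nonempty with h | h
    · refine ⟨0, fun y hy => ?_⟩
      rw [← Multiset.mem_toFinset, h] at hy
      simp at hy
    · obtain ⟨z, hz, hzmin⟩ := Finset.exists_min_image _ (fun z => ‖z - ζ‖) h
      exact ⟨z, fun y hy => ⟨Multiset.mem_toFinset.1 hz, hzmin y (Multiset.mem_toFinset.2 hy)⟩⟩
  choose z hz using hmin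
  refine ⟨z, ?_, Metric.tendsto_nhds.2 fun ε hε => ?_⟩
  · filter_upwards [hf0, eventually_exists_root_near hS hG hG0 hf hζ one_pos] with n hn ⟨y, hy, _⟩
    exact (mem_roots hn).1 (hz n y ((mem_roots hn).2 hy)).1
  · filter_upwards [hf0, eventually_exists_root_near hS hG hG0 hf hζ (half_pos hε)]
      with n hn ⟨y, hy, hyε⟩
    rw [dist_eq_norm]
    exact ((hz n y ((mem_roots hn).2 hy)).2.trans hyε).trans_lt (by linarith)

/-- Dividing by t - z_n is harmless on a large circle, and the maximum principle carries the
estimate inside. -/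
lemma ConvergesOnBounded.divByMonic {f : ℕ → ℂ[X]} {T : ℂ[X]} {G : ℂ → ℂ}
    (hG : Differentiable ℂ G) {ζ : ℂ} {z : ℕ → ℂ}
    (hf : ConvergesOnBounded f fun t => ((X - C ζ) * T).eval t * G t)
    (hz : ∀ᶠ n in Filter.atTop, (f n).IsRoot (z n))
    (hzt : Filter.Tendsto z Filter.atTop (nhds ζ)) :
    ConvergesOnBounded (fun n => f n /ₘ (X - C (z n))) fun t => T.eval t * G t := by
  intro R ε hε
  -- Once z_n is within 1 of `ζ`, the circle of radius `R'` stays at distance at least 1 from it.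
  set R' := |R| + ‖ζ‖ + 2 with hR'
  have hR'0 : 0 < R' := by positivity
  obtain ⟨M, hM⟩ := (isCompact_closedBall (0 : ℂ) R').exists_bound_of_continuousOn
    (f := fun t => T.eval t * G t) (T.continuous.mul hG.continuous).continuousOn
  have hM0 : 0 ≤ M := (norm_nonneg _).trans (hM 0 (by simp [hR'0.le]))
  have hη : 0 < min 1 (ε / (2 * (M + 1))) := by positivity
  filter_upwards [hf R' (ε / 2) (by positivity), hz, Metric.tendsto_nhds.1 hzt _ hη]
    with n hn hroot hnear t ht
  rw [dist_eq_norm, lt_min_iff] at hnear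
  have hfac : (X - C (z n)) * (f n /ₘ (X - C (z n))) = f n := mul_divByMonic_eq_iff_isRoot.2 hroot
  set g := f n /ₘ (X - C (z n)) with hg
  have hdiff : DiffContOnCl ℂ (fun t => g.eval t - T.eval t * G t) (Metric.ball 0 R') :=
    (g.differentiable.sub (T.differentiable.mul hG)).diffContOnCl
  refine Complex.norm_le_of_forall_mem_frontier_norm_le Metric.isBounded_ball hdiff
    (fun s hs => ?_) (z := t) ?_
  · rw [frontier_ball _ hR'0.ne', mem_sphere_zero_iff_norm] at hs
    have h1 : (s - z n) * (g.eval s - T.eval s * G s) =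
        ((f n).eval s - ((X - C ζ) * T).eval s * G s) + (z n - ζ) * (T.eval s * G s) := by
      rw [← hfac]
      simp only [eval_mul, eval_sub, eval_X, eval_C]
      ring
    have h2 : 1 ≤ ‖s - z n‖ := by
      have e1 := norm_sub_norm_le s (z n)
      have e2 := norm_sub_norm_le (z n) ζ
      have := abs_nonneg R
      linarith [hnear.1]
    have h3 := hn s hs.le
    have h4 := hM s (by rw [mem_closedBall_zero_iff]; exact hs.le)
    have h5 : ‖z n - ζ‖ * ‖T.eval s * G s‖ ≤ ε / 2 := by
      calc _ ≤ ε / (2 * (M + 1)) * (M + 1) := by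
            gcongr
            · exact hnear.2.le
            · linarith
        _ = ε / 2 := by field_simp
    calc ‖g.eval s - T.eval s * G s‖ ≤ ‖s - z n‖ * ‖g.eval s - T.eval s * G s‖ :=
          le_mul_of_one_le_left (norm_nonneg _) h2
      _ = _ := by rw [← norm_mul, h1]
      _ ≤ ε / 2 + ε / 2 := (norm_add_le _ _).trans (add_le_add h3 (by rwa [norm_mul]))
      _ = ε := by ring
  · rw [closure_ball _ hR'0.ne', mem_closedBall_zero_iff]
    have := le_abs_self R
    have := norm_nonneg ζ
    linarith

/-- Multiplicities are handled by deflation: a non-real zero of `S` and the zeros of `f n` tending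
to it are divided out, and the quotients still converge. -/
lemma eventually_countP_le_countP_roots (d : ℕ) {f : ℕ → ℂ[X]} {S : ℂ[X]} {G : ℂ → ℂ}
    (hS : S ≠ 0) (hG : Differentiable ℂ G) (hG0 : ∀ t, G t ≠ 0)
    (hf0 : ∀ᶠ n in Filter.atTop, f n ≠ 0)
    (hf : ConvergesOnBounded f fun t => S.eval t * G t)
    (hd : S.roots.countP (fun z => z.im ≠ 0) = d) :
    ∀ᶠ n in Filter.atTop, d ≤ (f n).roots.countP (fun z => z.im ≠ 0) := by
  induction d generalizing f S with
  | zero => simp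
  | succ d ih =>
    obtain ⟨ζ, hζ, him⟩ := Multiset.countP_pos.1 (by rw [hd]; exact Nat.succ_pos d :
      0 < S.roots.countP (fun z => z.im ≠ 0))
    have hζ' := (mem_roots hS).1 hζ
    obtain ⟨z, hz, hzt⟩ := exists_root_tendsto hS hG hG0 hf0 hf hζ'
    obtain ⟨T, rfl⟩ := dvd_iff_isRoot.2 hζ'
    have hT0 : T ≠ 0 := right_ne_zero_of_mul hS
    rw [roots_mul hS, roots_X_sub_C, Multiset.singleton_add, Multiset.countP_cons, if_pos him,
      Nat.add_right_cancel_iff] at hd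
    have hfac : ∀ᶠ n in Filter.atTop, (X - C (z n)) * (f n /ₘ (X - C (z n))) = f n :=
      hz.mono fun n hn => mul_divByMonic_eq_iff_isRoot.2 hn
    have hg0 : ∀ᶠ n in Filter.atTop, f n /ₘ (X - C (z n)) ≠ 0 := by
      filter_upwards [hf0, hfac] with n hn hfn h
      rw [h, mul_zero] at hfn
      exact hn hfn.symm
    have hzim : ∀ᶠ n in Filter.atTop, (z n).im ≠ 0 :=
      ((Complex.continuous_im.tendsto ζ).comp hzt).eventually_ne him
    filter_upwards [ih hT0 hg0 (hf.divByMonic hG hz hzt) hd, hf0, hfac, hzim] with n h1 h2 h3 h4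
    rw [← h3] at h2 ⊢
    rw [roots_mul h2, roots_X_sub_C, Multiset.singleton_add, Multiset.countP_cons, if_pos h4]
    omega

/-! ### Products of linear factors with prescribed reciprocal zeros -/

/-- The product of the factors `1 - z X` over the multiset `s`. -/
noncomputable def reciprocalProd (s : Multiset ℂ) : ℂ[X] := (s.map fun z => 1 - C z * X).prod

lemma one_sub_C_mul_X_ne_zero (z : ℂ) : (1 - C z * X : ℂ[X]) ≠ 0 := by
  intro h
  have := congrArg (eval 0) h
  simp at this

lemma reciprocalProd_ne_zero (s : Multiset ℂ) : reciprocalProd s ≠ 0 := by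
  rw [reciprocalProd, Ne, Multiset.prod_eq_zero_iff, Multiset.mem_map]
  rintro ⟨z, -, hz⟩
  exact one_sub_C_mul_X_ne_zero z hz

lemma countP_roots_one_sub_C_mul_X (z : ℂ) :
    (1 - C z * X : ℂ[X]).roots.countP (fun z => z.im ≠ 0) = if z.im ≠ 0 then 1 else 0 := by
  by_cases hz : z = 0
  · simp [hz]
  · have h : (1 - C z * X : ℂ[X]) = C (-z) * (X - C z⁻¹) := by
      rw [mul_sub, ← C_mul, neg_mul, mul_inv_cancel₀ hz]
      simp only [C_neg, C_1]
      ring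
    rw [h, roots_C_mul _ (neg_ne_zero.2 hz), roots_X_sub_C, ← Multiset.cons_zero,
      Multiset.countP_cons, Multiset.countP_zero, zero_add]
    congr 1
    simp [Complex.inv_im, hz]

/-- 1/z is non-real exactly when z is; z = 0 yields a constant factor and is not counted on either
side. -/
lemma countP_roots_reciprocalProd (s : Multiset ℂ) :
    (reciprocalProd s).roots.countP (fun z => z.im ≠ 0) = s.countP (fun z => z.im ≠ 0) := by
  induction s using Multiset.induction_on with
  | empty => simp [reciprocalProd]
  | cons z s ih =>
    have h : reciprocalProd (z ::ₘ s) = (1 - C z * X) * reciprocalProd s := by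
      simp [reciprocalProd]
    rw [h, roots_mul (h ▸ reciprocalProd_ne_zero _), Multiset.countP_add, ih,
      countP_roots_one_sub_C_mul_X, Multiset.countP_cons, add_comm]

lemma eval_reciprocalProd (s : Multiset ℂ) (t : ℂ) :
    (reciprocalProd s).eval t = (s.map fun z => 1 - z * t).prod := by
  rw [reciprocalProd, eval_multiset_prod, Multiset.map_map]
  simp

lemma eval_reciprocalProd_roots (p : ℂ[X]) {t : ℂ} (ht : t ≠ 0) :
    p.leadingCoeff * (reciprocalProd p.roots).eval t = t ^ p.natDegree * p.eval t⁻¹ := by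
  have hp := IsAlgClosed.splits p
  have h := congrArg (eval t⁻¹) hp.eq_prod_roots
  rw [eval_mul, eval_C, eval_multiset_prod, Multiset.map_map] at h
  rw [h, hp.natDegree_eq_card_roots, eval_reciprocalProd, mul_left_comm]
  congr 1
  generalize p.roots = s
  induction s using Multiset.induction_on with
  | empty => simp
  | cons z s ih =>
    simp only [Multiset.map_cons, Multiset.prod_cons, Multiset.card_cons, ih, Function.comp_apply,
      eval_sub, eval_X, eval_C, pow_succ]
    have : 1 - z * t = t * (t⁻¹ - z) := by field_simp
    rw [this]
    ring

/-! ### The scaling limit -/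

lemma coeff_zero_normHermite_two_mul (k : ℕ) :
    (normHermite (2 * k)).coeff 0 = (-1 / 4) ^ k / (k.factorial : ℝ) ∧
      (normHermite (2 * k + 1)).coeff 0 = 0 := by
  have hrec : ∀ n : ℕ, ((n : ℝ) + 2) * (normHermite (n + 2)).coeff 0 =
      -(2⁻¹ * (normHermite n).coeff 0) := by
    intro n
    have h := congrArg (fun p => p.coeff 0) (normHermite_three_term n)
    simpa [coeff_C_mul, mul_coeff_zero] using h
  induction k with
  | zero => simp [normHermite_zero, normHermite_one]
  | succ k ih =>
    constructor
    · have h := hrec (2 * k)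
      rw [ih.1] at h
      have h2 : ((2 * k : ℕ) : ℝ) + 2 ≠ 0 := by positivity
      rw [show 2 * (k + 1) = 2 * k + 2 by ring, ← mul_right_inj' h2, h, Nat.factorial_succ]
      have : (k.factorial : ℝ) ≠ 0 := by positivity
      push_cast
      field_simp
      ring
    · have h := hrec (2 * k + 1)
      rw [ih.2] at h
      have h2 : ((2 * k + 1 : ℕ) : ℝ) + 2 ≠ 0 := by positivity
      rw [mul_zero, neg_zero] at h
      exact (mul_eq_zero.1 h).resolve_left h2

lemma hasSum_coeff_zero_normHermite (t : ℂ) :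
    HasSum (fun k => (((normHermite k).coeff 0 : ℝ) : ℂ) * t ^ k) (Complex.exp (-t ^ 2 / 4)) := by
  rw [← add_zero (Complex.exp (-t ^ 2 / 4))]
  refine HasSum.even_add_odd ?_ ?_
  · have h := NormedSpace.expSeries_div_hasSum_exp (-t ^ 2 / 4)
    rw [← Complex.exp_eq_exp_ℂ] at h
    refine h.congr_fun fun k => ?_
    rw [(coeff_zero_normHermite_two_mul k).1]
    push_cast
    rw [pow_mul, show -t ^ 2 / 4 = (-1 / 4) * t ^ 2 by ring, mul_pow]
    ring
  · simp only [(coeff_zero_normHermite_two_mul _).2, Complex.ofReal_zero, zero_mul]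
    exact hasSum_zero

lemma coeff_zero_appell (S : ℝ[X]) (n : ℕ) : (appell S n).coeff 0 =
    ∑ i ∈ Finset.range (n + 1), S.coeff i * (normHermite (n - i)).coeff 0 := by
  simp [appell_eq_sum_range]

lemma hasSum_coeff_mul_pow (S : ℝ[X]) (t : ℂ) :
    HasSum (fun k => ((S.coeff k : ℝ) : ℂ) * t ^ k) ((S.map (algebraMap ℝ ℂ)).eval t) := by
  rw [eval_eq_sum_range' (n := S.natDegree + 1) (Nat.lt_succ_of_le natDegree_map_le)]
  simp only [coeff_map, Complex.coe_algebraMap]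
  refine hasSum_sum_of_ne_finset_zero fun k hk => ?_
  rw [coeff_eq_zero_of_natDegree_lt (by simpa using hk), Complex.ofReal_zero, zero_mul]

lemma coeff_zero_appell_mul_pow (S : ℝ[X]) (t : ℂ) (k : ℕ) :
    (((appell S k).coeff 0 : ℝ) : ℂ) * t ^ k =
      ∑ i ∈ Finset.range (k + 1), (((S.coeff i : ℝ) : ℂ) * t ^ i) *
        ((((normHermite (k - i)).coeff 0 : ℝ) : ℂ) * t ^ (k - i)) := by
  rw [coeff_zero_appell]
  push_cast
  rw [Finset.sum_mul]
  refine Finset.sum_congr rfl fun i hi => ?_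
  rw [show t ^ k = t ^ i * t ^ (k - i) by
    rw [← pow_add, Nat.add_sub_cancel' (Finset.mem_range_succ_iff.1 hi)]]
  ring

lemma summable_norm_coeff_zero_appell (S : ℝ[X]) (t : ℂ) :
    Summable fun k => ‖(((appell S k).coeff 0 : ℝ) : ℂ) * t ^ k‖ := by
  have h1 := (hasSum_coeff_mul_pow S t).summable.norm
  have h2 := (hasSum_coeff_zero_normHermite t).summable.norm
  have h3 := summable_norm_sum_mul_range_of_summable_norm h1 h2
  exact h3.congr fun k => by rw [coeff_zero_appell_mul_pow]

lemma hasSum_coeff_zero_appell (S : ℝ[X]) (t : ℂ) :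
    HasSum (fun k => (((appell S k).coeff 0 : ℝ) : ℂ) * t ^ k)
      ((S.map (algebraMap ℝ ℂ)).eval t * Complex.exp (-t ^ 2 / 4)) := by
  rw [← (hasSum_coeff_mul_pow S t).tsum_eq, ← (hasSum_coeff_zero_normHermite t).tsum_eq]
  have h1 := (hasSum_coeff_mul_pow S t).summable.norm
  have h2 := (hasSum_coeff_zero_normHermite t).summable.norm
  have h3 := hasSum_sum_range_mul_of_summable_norm h1 h2
  exact h3.congr_fun fun k => coeff_zero_appell_mul_pow S t k

lemma tendsto_descFactorial_div_pow (k : ℕ) :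
    Filter.Tendsto (fun n : ℕ => (n.descFactorial k : ℝ) / (n : ℝ) ^ k) Filter.atTop (nhds 1) := by
  induction k with
  | zero => simp
  | succ k ih =>
    have h1 : Filter.Tendsto (fun n : ℕ => 1 - (k : ℝ) / (n : ℝ)) Filter.atTop (nhds 1) := by
      simpa using (tendsto_const_div_atTop_nhds_zero_nat (k : ℝ)).const_sub 1
    have h2 := h1.mul ih
    rw [one_mul] at h2
    refine h2.congr' ?_
    filter_upwards [Filter.eventually_ge_atTop (k + 1)] with n hn
    have hn0 : (n : ℝ) ≠ 0 := by
      have : 0 < n := by omega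
      positivity
    rw [Nat.descFactorial_succ, Nat.cast_mul, Nat.cast_sub (by omega), pow_succ]
    field_simp

/-- The polynomial `t ↦ n! (t / n) ^ n p(n / t)`, for `p = appell S n` of leading coefficient
`1 / n!`. -/
noncomputable def scaledReciprocal (S : ℝ[X]) (n : ℕ) : ℂ[X] :=
  reciprocalProd ((((appell S n).map (algebraMap ℝ ℂ)).roots).map fun z => z / (n : ℂ))

lemma countP_roots_scaledReciprocal (S : ℝ[X]) {n : ℕ} (hn : n ≠ 0) :
    (scaledReciprocal S n).roots.countP (fun z => z.im ≠ 0) = nonRealZeroCount (appell S n) := by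
  rw [scaledReciprocal, countP_roots_reciprocalProd, Multiset.countP_map, nonRealZeroCount,
    Multiset.countP_eq_card_filter]
  congr 2
  ext z
  simp [Complex.div_natCast_im, hn]

/-- The coefficient of x^{n-k} in q_n is q_k(0)/(n-k)!, and n!/(n-k)! is the falling factorial. -/
lemma eval_scaledReciprocal {S : ℝ[X]} (hS : S.coeff 0 = 1) {n : ℕ} (hn : n ≠ 0) (t : ℂ) :
    (scaledReciprocal S n).eval t = ∑ k ∈ Finset.range (n + 1),
      (((appell S k).coeff 0 : ℝ) : ℂ) * (((n.descFactorial k : ℝ) / (n : ℝ) ^ k : ℝ) : ℂ) *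
        t ^ k := by
  have hnC : (n : ℂ) ≠ 0 := Nat.cast_ne_zero.2 hn
  have hS0 : S.coeff 0 ≠ 0 := by rw [hS]; exact one_ne_zero
  have hscale : (scaledReciprocal S n).eval t =
      (reciprocalProd ((appell S n).map (algebraMap ℝ ℂ)).roots).eval (t / n) := by
    rw [scaledReciprocal, eval_reciprocalProd, eval_reciprocalProd, Multiset.map_map]
    congr 2
    ext z
    simp only [Function.comp_apply]
    ring
  rcases eq_or_ne t 0 with rfl | ht
  · rw [Finset.sum_range_succ']
    simp [eval_reciprocalProd, hscale, appell_zero, hS]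
  · have hf : ((n.factorial : ℝ) : ℂ) ≠ 0 := by
      rw [Complex.ofReal_ne_zero]; positivity
    have hdeg : ((appell S n).map (algebraMap ℝ ℂ)).natDegree = n := by
      rw [natDegree_map, natDegree_appell hS0]
    have hlc : ((appell S n).map (algebraMap ℝ ℂ)).leadingCoeff = 1 / ((n.factorial : ℝ) : ℂ) := by
      rw [leadingCoeff, hdeg, coeff_map, coeff_appell_self, hS]
      simp
    have h := eval_reciprocalProd_roots ((appell S n).map (algebraMap ℝ ℂ)) (div_ne_zero ht hnC)
    rw [hlc, hdeg, eval_eq_sum_range' (p := (appell S n).map (algebraMap ℝ ℂ)) (n := n + 1)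
      (by omega), ← hscale,
      one_div_mul_eq_div, div_eq_iff hf] at h
    rw [h, ← Finset.sum_flip, Finset.mul_sum, Finset.sum_mul]
    refine Finset.sum_congr rfl fun k hk => ?_
    have hk' := Finset.mem_range_succ_iff.1 hk
    rw [coeff_map, coeff_appell, if_pos (Nat.sub_le _ _), Nat.sub_sub_self hk',
      ← Nat.factorial_mul_descFactorial hk']
    have hf' : (((n - k).factorial : ℕ) : ℂ) ≠ 0 := by
      exact_mod_cast Nat.factorial_ne_zero _
    have hpow : (t / n) ^ n = (t / n) ^ k * (t / n) ^ (n - k) := by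
      rw [← pow_add, Nat.add_sub_cancel' hk']
    rw [hpow, inv_pow, div_pow t (n : ℂ) k]
    have htn : (t / n) ^ (n - k) ≠ 0 := pow_ne_zero _ (div_ne_zero ht hnC)
    generalize (t / n) ^ (n - k) = u at htn
    simp only [Complex.coe_algebraMap]
    push_cast
    field_simp

/-- Dominated convergence: the weights `ρ n k` lie in [0, 1] and tend to 1 for fixed k, while the
limit series converges absolutely everywhere. -/
lemma convergesOnBounded_scaledReciprocal {S : ℝ[X]} (hS : S.coeff 0 = 1) :
    ConvergesOnBounded (scaledReciprocal S)
      fun t => (S.map (algebraMap ℝ ℂ)).eval t * Complex.exp (-t ^ 2 / 4) := by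
  intro R ε hε
  set c : ℕ → ℝ := fun k => (appell S k).coeff 0 with hc
  set ρ : ℕ → ℕ → ℝ := fun n k => (n.descFactorial k : ℝ) / (n : ℝ) ^ k with hρ
  have hρ0 : ∀ n k, 0 ≤ ρ n k := fun n k => by positivity
  have hρ1 : ∀ n k, ρ n k ≤ 1 := fun n k => by
    refine div_le_one_of_le₀ ?_ (by positivity)
    exact_mod_cast Nat.descFactorial_le_pow n k
  have hsum : Summable fun k => |c k| * |R| ^ k := by
    refine (summable_norm_coeff_zero_appell S (R : ℂ)).congr fun k => ?_
    simp [hc]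
  have hbound : ∀ n k, |c k| * |R| ^ k * (1 - ρ n k) ≤ |c k| * |R| ^ k := fun n k =>
    mul_le_of_le_one_right (by positivity) (by linarith [hρ0 n k])
  have hnonneg : ∀ n k, 0 ≤ |c k| * |R| ^ k * (1 - ρ n k) := fun n k =>
    mul_nonneg (by positivity) (by linarith [hρ1 n k])
  have hlim : Filter.Tendsto (fun n => ∑' k, |c k| * |R| ^ k * (1 - ρ n k)) Filter.atTop
      (nhds 0) := by
    have h : Filter.Tendsto (fun n => ∑' k, |c k| * |R| ^ k * (1 - ρ n k)) Filter.atTop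
        (nhds (∑' _ : ℕ, (0 : ℝ))) := by
      refine tendsto_tsum_of_dominated_convergence hsum (fun k => ?_)
        (Filter.Eventually.of_forall fun n k => ?_)
      · simpa using ((tendsto_descFactorial_div_pow k).const_sub 1).const_mul (|c k| * |R| ^ k)
      · rw [Real.norm_of_nonneg (hnonneg n k)]
        exact hbound n k
    simpa using h
  filter_upwards [hlim.eventually_le_const hε, Filter.eventually_ne_atTop 0] with n hn hn0 t ht
  have hF := hasSum_coeff_zero_appell S t
  have hR : HasSum (fun k => ((c k : ℝ) : ℂ) * ((ρ n k : ℝ) : ℂ) * t ^ k)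
      ((scaledReciprocal S n).eval t) := by
    rw [eval_scaledReciprocal hS hn0]
    -- The weight vanishes for k > n, so the finite sum is a full series.
    refine hasSum_sum_of_ne_finset_zero fun k hk => ?_
    have : n.descFactorial k = 0 := Nat.descFactorial_eq_zero_iff_lt.2 (by simpa using hk)
    simp [hρ, this]
  refine le_trans ?_ hn
  rw [← (hR.sub hF).tsum_eq]
  refine tsum_of_norm_bounded
    (Summable.of_nonneg_of_le (hnonneg n) (hbound n) hsum).hasSum fun k => ?_
  have h1 : ((c k : ℝ) : ℂ) * ((ρ n k : ℝ) : ℂ) * t ^ k - ((c k : ℝ) : ℂ) * t ^ k =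
      -(((c k : ℝ) : ℂ) * t ^ k * ((1 - ρ n k : ℝ) : ℂ)) := by
    push_cast; ring
  rw [h1, norm_neg, norm_mul, norm_mul, norm_pow, Complex.norm_real, Complex.norm_real,
    Real.norm_eq_abs, Real.norm_of_nonneg (by linarith [hρ1 n k])]
  have := hρ1 n k
  have ht' : ‖t‖ ≤ |R| := ht.trans (le_abs_self R)
  gcongr

lemma eventually_nonRealZeroCount_le_appell {S : ℝ[X]} (hS : S.coeff 0 = 1) :
    ∀ᶠ n in Filter.atTop, nonRealZeroCount S ≤ nonRealZeroCount (appell S n) := by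
  have hS0 : S.map (algebraMap ℝ ℂ) ≠ 0 := by
    rw [Ne, Polynomial.map_eq_zero]
    rintro rfl
    simp at hS
  have h := eventually_countP_le_countP_roots (nonRealZeroCount S) hS0
    (G := fun t => Complex.exp (-t ^ 2 / 4)) (by fun_prop) (fun t => Complex.exp_ne_zero _)
    (f := scaledReciprocal S) (Filter.Eventually.of_forall fun n => reciprocalProd_ne_zero _)
    (convergesOnBounded_scaledReciprocal hS) rfl
  filter_upwards [h, Filter.eventually_ne_atTop 0] with n hn hn0
  rwa [countP_roots_scaledReciprocal S hn0] at hn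

/-! ### Simplicity of the real zeros -/

/-- Equality in the count leaves room only for simple zeros of p' outside the zeros of `p`. -/
lemma isRoot_of_one_lt_rootMultiplicity_derivative {p : ℝ[X]} (hd : derivative p ≠ 0)
    (hcard : Multiset.card p.roots = Multiset.card (derivative p).roots + 1) {x : ℝ}
    (hx : 1 < (derivative p).rootMultiplicity x) : p.IsRoot x := by
  by_contra hnr
  have h1 := card_roots_add_sum_le (p := p) (g := derivative p)
    (fun x => rootMultiplicity_sub_one_le_derivative_rootMultiplicity p x)
  have h2 := p.card_roots_toFinset_le_card_roots_derivative_sdiff_roots_succ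
  set T := (derivative p).roots.toFinset \ p.roots.toFinset with hT
  have hxT : x ∈ T := by
    rw [hT, Finset.mem_sdiff, Multiset.mem_toFinset, Multiset.mem_toFinset, mem_roots hd]
    exact ⟨(rootMultiplicity_pos hd).1 (by omega), fun h => hnr (isRoot_of_mem_roots h)⟩
  have h3 := card_le_sum_rootMultiplicity (g := derivative p) (T := T.erase x)
    ((Finset.erase_subset _ _).trans Finset.sdiff_subset)
  have h4 := Finset.card_erase_add_one hxT
  have h5 := Finset.sum_erase_add T (fun y => (derivative p).rootMultiplicity y) hxT
  omega

lemma mk_eval_appell (S : ℝ[X]) (x : ℝ) :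
    PowerSeries.mk (fun n => (appell S n).eval x) =
      (S : PowerSeries ℝ) * PowerSeries.mk fun n => (normHermite n).eval x := by
  ext n
  rw [PowerSeries.coeff_mul, Finset.Nat.sum_antidiagonal_eq_sum_range_succ_mk,
    PowerSeries.coeff_mk, appell_eq_sum_range, eval_finsetSum]
  simp

/-- The formal equation E' = (x - t/2) E of E = exp(xt - t²/4). -/
lemma derivative_mk_eval_normHermite (x : ℝ) :
    PowerSeries.derivative ℝ (PowerSeries.mk fun n => (normHermite n).eval x) =
      ((C x - C 2⁻¹ * X : ℝ[X]) : PowerSeries ℝ) *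
        PowerSeries.mk fun n => (normHermite n).eval x := by
  ext n
  rw [PowerSeries.coeff_derivative, PowerSeries.coeff_mk, Polynomial.coe_sub, Polynomial.coe_mul,
    Polynomial.coe_C, Polynomial.coe_C, Polynomial.coe_X, sub_mul, map_sub, mul_assoc,
    PowerSeries.coeff_C_mul, PowerSeries.coeff_C_mul]
  cases n with
  | zero => simp [normHermite_zero, normHermite_one]
  | succ n =>
    have h := congrArg (eval x) (normHermite_three_term n)
    simp only [eval_mul, eval_sub, eval_C, eval_X] at h
    rw [PowerSeries.coeff_succ_X_mul, PowerSeries.coeff_mk, PowerSeries.coeff_mk, ← h]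
    push_cast
    ring

lemma exists_not_isRoot_appell {S : ℝ[X]} (hS : S.coeff 0 ≠ 0) (x : ℝ) (n : ℕ) :
    ∃ m, n ≤ m ∧ ¬ (appell S m).IsRoot x := by
  by_contra! hall
  set E : PowerSeries ℝ := PowerSeries.mk fun n => (normHermite n).eval x with hE
  set A : ℝ[X] := PowerSeries.trunc n ((S : PowerSeries ℝ) * E) with hA
  have hAE : (A : PowerSeries ℝ) = (S : PowerSeries ℝ) * E := by
    ext m
    rw [Polynomial.coeff_coe, hA, PowerSeries.coeff_trunc]
    split_ifs with h
    · rfl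
    · rw [hE, ← mk_eval_appell, PowerSeries.coeff_mk]
      exact (hall m (not_lt.1 h)).eq_zero.symm
  have hS0 : S ≠ 0 := by rintro rfl; simp at hS
  have hA0 : A ≠ 0 := by
    intro h
    have h1 := congrArg (PowerSeries.coeff 0) hAE
    rw [h, hE, ← mk_eval_appell, PowerSeries.coeff_mk, appell_zero] at h1
    simp at h1
    exact hS h1.symm
  -- Differentiating A = S E and multiplying by `S` eliminates E; the last term then has a degree no
  -- other term reaches.
  have hder : derivative A * S = derivative S * A + S * (C x - C 2⁻¹ * X) * A := by
    have h1 := congrArg (PowerSeries.derivative ℝ) hAE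
    rw [Derivation.leibniz, hE, derivative_mk_eval_normHermite, ← hE, smul_eq_mul, smul_eq_mul,
      PowerSeries.derivative_coe, PowerSeries.derivative_coe] at h1
    apply Polynomial.coe_injective
    simp only [Polynomial.coe_mul, Polynomial.coe_add] at h1 ⊢
    rw [h1, hAE]
    ring
  have hlin : (C x - C 2⁻¹ * X : ℝ[X]).natDegree = 1 := by
    rw [show (C x - C 2⁻¹ * X : ℝ[X]) = C (-2⁻¹) * X + C x by rw [C_neg]; ring]
    exact natDegree_linear (by norm_num)
  have hlin0 : (C x - C 2⁻¹ * X : ℝ[X]) ≠ 0 := by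
    intro h
    rw [h] at hlin
    simp at hlin
  have h1 : (S * (C x - C 2⁻¹ * X) * A).natDegree = S.natDegree + 1 + A.natDegree := by
    rw [natDegree_mul (mul_ne_zero hS0 hlin0) hA0, natDegree_mul hS0 hlin0, hlin]
  have h2 : (derivative A * S - derivative S * A).natDegree ≤ S.natDegree + A.natDegree := by
    refine (natDegree_sub_le _ _).trans (max_le ?_ ?_)
    · have := natDegree_derivative_le A
      exact natDegree_mul_le.trans (by omega)
    · have := natDegree_derivative_le S
      exact natDegree_mul_le.trans (by omega)
  rw [hder, add_sub_cancel_left, h1] at h2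
  omega

lemma card_roots_appell_succ {S : ℝ[X]} (hS : S.coeff 0 ≠ 0) {n : ℕ}
    (h : nonRealZeroCount (appell S (n + 1)) = nonRealZeroCount (appell S n)) :
    Multiset.card (appell S (n + 1)).roots = Multiset.card (appell S n).roots + 1 := by
  have h1 := realZeroCount_add_nonRealZeroCount (appell S n)
  have h2 := realZeroCount_add_nonRealZeroCount (appell S (n + 1))
  rw [natDegree_appell hS] at h1 h2
  unfold realZeroCount at h1 h2
  omega

/-- A multiple zero of q_m = q_{m+1}' must be a zero of q_{m+1}, hence again a multiple one; so it
would persist for all larger indices. -/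
lemma simpleRealZeros_appell {S : ℝ[X]} (hS : S.coeff 0 ≠ 0) {n : ℕ}
    (h : ∀ m, n ≤ m → nonRealZeroCount (appell S m) = nonRealZeroCount (appell S n)) :
    SimpleRealZeros (appell S n) := by
  intro x hx
  by_contra hne
  have hpos := (rootMultiplicity_pos (appell_ne_zero hS n)).2 hx
  have hall : ∀ m, n ≤ m → 1 < (appell S m).rootMultiplicity x := by
    intro m hm
    induction m, hm using Nat.le_induction with
    | base => omega
    | succ m hm ih =>
      have hc := card_roots_appell_succ hS ((h (m + 1) (by omega)).trans (h m hm).symm)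
      rw [← derivative_appell_succ S m] at ih hc
      have hd : derivative (appell S (m + 1)) ≠ 0 := by
        rw [derivative_appell_succ]; exact appell_ne_zero hS m
      rw [one_lt_rootMultiplicity_iff_isRoot (appell_ne_zero hS _)]
      exact ⟨isRoot_of_one_lt_rootMultiplicity_derivative hd hc ih,
        (rootMultiplicity_pos hd).1 (by omega)⟩
  obtain ⟨m, hm, hmx⟩ := exists_not_isRoot_appell hS x n
  exact hmx ((rootMultiplicity_pos (appell_ne_zero hS m)).1 (by have := hall m hm; omega))

/-! ### Interlacing -/

/-- By cardinality no element of `V` is dispensable for separating `U`. Failure of the first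
condition would make min V dispensable; failure of the last, the left endpoint a. -/
lemma interlaces_of_card {U V : Finset ℝ} (hcard : V.card < U.card) (hdisj : Disjoint U V)
    (hUV : ∀ a ∈ U, ∀ b ∈ U, a < b → ∃ v ∈ V, a < v ∧ v < b) : Interlaces U V := by
  have herase : ∀ v ∈ V, ¬ ∀ a ∈ U, ∀ b ∈ U, a < b → ∃ w ∈ V.erase v, a < w ∧ w < b := by
    intro v hv h
    have h1 := Finset.card_le_of_interleaved fun a ha b hb hab _ => h a ha b hb hab
    have h2 := Finset.card_erase_add_one hv
    omega
  refine ⟨?_, fun a b hab => hUV a hab.1 b hab.2.1 hab.2.2.1, fun a b hab => ?_⟩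
  · rcases V.eq_empty_or_nonempty with rfl | hV
    · obtain ⟨u, hu⟩ := Finset.card_pos.1 ((Nat.zero_le _).trans_lt hcard)
      exact ⟨u, hu, by simp⟩
    · by_contra! hno
      refine herase _ (V.min'_mem hV) fun a ha b hb hab => ?_
      obtain ⟨w, hw, haw, hwb⟩ := hUV a ha b hb hab
      obtain ⟨v, hv, hva⟩ := hno a ha
      exact ⟨w, Finset.mem_erase.2
        ⟨(((V.min'_le v hv).trans hva).trans_lt haw).ne', hw⟩, haw, hwb⟩
  · obtain ⟨ha, hb, hlt, hcons⟩ := hab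
    by_contra! hno
    -- With no element of `U` in (a, b), every gap of `U` around a also contains b, which can
    -- replace it; disjointness excludes b as its endpoint.
    refine herase a ha fun u hu u' hu' huu' => ?_
    obtain ⟨w, hw, huw, hwu'⟩ := hUV u hu u' hu' huu'
    rcases eq_or_ne w a with rfl | hne
    · refine ⟨b, Finset.mem_erase.2 ⟨hlt.ne', hb⟩, huw.trans hlt, ?_⟩
      refine lt_of_le_of_ne (hno u' hu' hwu') ?_
      rintro rfl
      exact Finset.disjoint_left.1 hdisj hu' hb
    · exact ⟨w, Finset.mem_erase.2 ⟨hne, hw⟩, huw, hwu'⟩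

lemma interlaces_appell {S : ℝ[X]} (hS : S.coeff 0 ≠ 0) {n : ℕ}
    (h : nonRealZeroCount (appell S (n + 1)) = nonRealZeroCount (appell S n))
    (hsimple : SimpleRealZeros (appell S (n + 1))) :
    Interlaces (realZeros (appell S (n + 1))) (realZeros (appell S n)) := by
  have h0 := appell_ne_zero hS n
  have h1 := appell_ne_zero hS (n + 1)
  refine interlaces_of_card ?_ ?_ ?_
  · have hnodup : (appell S (n + 1)).roots.Nodup := by
      rw [Multiset.nodup_iff_count_eq_one]
      intro x hx
      rw [count_roots]
      exact hsimple x ((mem_roots h1).1 hx)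
    have hc := card_roots_appell_succ hS h
    have hle := Multiset.toFinset_card_le (appell S n).roots
    rw [realZeros, realZeros, Multiset.toFinset_card_of_nodup hnodup]
    omega
  · rw [Finset.disjoint_left]
    intro x hx hx'
    rw [realZeros, Multiset.mem_toFinset, mem_roots h1] at hx
    rw [realZeros, Multiset.mem_toFinset, mem_roots h0, ← derivative_appell_succ] at hx'
    have := (one_lt_rootMultiplicity_iff_isRoot h1).2 ⟨hx, hx'⟩
    rw [hsimple x hx] at this
    exact lt_irrefl _ this
  · intro a ha b hb hab
    rw [realZeros, Multiset.mem_toFinset, mem_roots h1] at ha hb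
    -- Exponent 0 gives the classical Rolle theorem.
    obtain ⟨z, haz, hzb, hz⟩ := exists_isRoot_twistedDerivative 0 _ hab ha hb
    refine ⟨z, ?_, haz, hzb⟩
    rw [realZeros, Multiset.mem_toFinset, mem_roots h0]
    simpa [twistedDerivative, derivative_appell_succ] using hz

/-! ### The polynomial with coefficients `γ` -/

/-- The polynomial `∑ γ_j x^j`, reciprocal to `P`. -/
noncomputable def symbol (K : ℕ) (γ : ℕ → ℝ) : ℝ[X] :=
  ∑ j ∈ Finset.range (K + 1), C (γ j) * X ^ j

lemma coeff_symbol (K : ℕ) (γ : ℕ → ℝ) (j : ℕ) :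
    (symbol K γ).coeff j = if j < K + 1 then γ j else 0 := by
  simp [symbol]

lemma q_eq_appell (K : ℕ) (γ : ℕ → ℝ) (n : ℕ) : q K γ n = appell (symbol K γ) n := by
  have hdeg : (symbol K γ).natDegree < K + 1 := by
    rw [Nat.lt_succ_iff, natDegree_le_iff_coeff_eq_zero]
    intro m hm
    rw [coeff_symbol, if_neg (by omega)]
  rw [q, appell_eq_sum hdeg]
  refine Finset.sum_congr rfl fun j hj => ?_
  rw [coeff_symbol, if_pos (Finset.mem_range.1 hj)]

/-- `P` is monic, so its reciprocal `symbol K γ` is the product of 1 - zX over the complex zeros z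
of `P`. -/
lemma nonRealZeroCount_symbol {K : ℕ} {γ : ℕ → ℝ} (hγ0 : γ 0 = 1) :
    nonRealZeroCount (symbol K γ) = nonRealZeroCount (P K γ) := by
  have hcoeff : (P K γ).coeff K = 1 := by
    rw [P, finsetSum_coeff, Finset.sum_eq_single 0]
    · simp [hγ0]
    · intro j hj hj0
      rw [coeff_C_mul_X_pow, if_neg]
      rw [Finset.mem_range] at hj
      omega
    · simp
  have hdeg : (P K γ).natDegree = K := by
    refine natDegree_eq_of_le_of_coeff_ne_zero ?_ (by rw [hcoeff]; exact one_ne_zero)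
    refine natDegree_sum_le_of_forall_le _ _ fun j _ => ?_
    exact (natDegree_C_mul_X_pow_le _ _).trans (Nat.sub_le _ _)
  have hlc : ((P K γ).map (algebraMap ℝ ℂ)).leadingCoeff = 1 := by
    rw [leadingCoeff, natDegree_map, hdeg, coeff_map, hcoeff, map_one]
  have h : (symbol K γ).map (algebraMap ℝ ℂ) =
      reciprocalProd ((P K γ).map (algebraMap ℝ ℂ)).roots := by
    refine eq_of_infinite_eval_eq _ _ ((Set.finite_singleton (0 : ℂ)).infinite_compl.mono ?_)
    intro t ht
    have ht : t ≠ 0 := ht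
    have h1 := eval_reciprocalProd_roots ((P K γ).map (algebraMap ℝ ℂ)) ht
    rw [hlc, one_mul, natDegree_map, hdeg] at h1
    rw [Set.mem_ofPred_eq, h1, symbol, P, Polynomial.map_sum, Polynomial.map_sum, eval_finsetSum,
      eval_finsetSum, Finset.mul_sum]
    refine Finset.sum_congr rfl fun j hj => ?_
    have hj := Finset.mem_range_succ_iff.1 hj
    simp only [Polynomial.map_mul, map_C, Polynomial.map_pow, map_X, eval_mul, eval_C, eval_pow,
      eval_X]
    rw [← Nat.sub_add_cancel hj, pow_add, Nat.add_sub_cancel, inv_pow]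
    field_simp
  rw [nonRealZeroCount, h, countP_roots_reciprocalProd, nonRealZeroCount]

lemma onlyRealZeros_iff {p : ℝ[X]} (hp : p ≠ 0) : OnlyRealZeros p ↔ nonRealZeroCount p = 0 := by
  rw [nonRealZeroCount, Multiset.countP_eq_zero]
  refine forall_congr' fun z => ?_
  rw [mem_roots (by rwa [Ne, Polynomial.map_eq_zero]), IsRoot, eval_map_algebraMap, not_not]

end HermiteAppell

/-! ### Assembly: a nondecreasing count that attains its upper bound. -/

theorem mainTheorem3 (K : ℕ) (hK : 0 < K) (γ : ℕ → ℝ) (hγ0 : γ 0 = 1) (hγK : γ K ≠ 0)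
    (N : ℕ) (hN : HermiteAppell.nonRealZeroCount (HermiteAppell.P K γ) = N) :
    ((∀ n : ℕ, HermiteAppell.OnlyRealZeros (HermiteAppell.q K γ n)) ↔ N = 0) ∧
    (N = 0 → ∀ n : ℕ,
      HermiteAppell.SimpleRealZeros (HermiteAppell.q K γ n) ∧
      HermiteAppell.Interlaces (HermiteAppell.realZeros (HermiteAppell.q K γ (n + 1)))
        (HermiteAppell.realZeros (HermiteAppell.q K γ n))) ∧
    (0 < N → ∃ n₀ : ℕ,
      IsLeast {n : ℕ | HermiteAppell.nonRealZeroCount (HermiteAppell.q K γ n) = N} n₀ ∧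
      (∀ n : ℕ,
        (((HermiteAppell.realZeroCount (HermiteAppell.q K γ n) : ℤ) = (n : ℤ) - (N : ℤ)) ∧
          HermiteAppell.nonRealZeroCount (HermiteAppell.q K γ n) = N) ↔ n₀ ≤ n) ∧
      (∀ n : ℕ, n₀ ≤ n →
        HermiteAppell.SimpleRealZeros (HermiteAppell.q K γ n) ∧
        HermiteAppell.Interlaces (HermiteAppell.realZeros (HermiteAppell.q K γ (n + 1)))
          (HermiteAppell.realZeros (HermiteAppell.q K γ n)))) := by
  set S := HermiteAppell.symbol K γ with hSdef
  have hS1 : S.coeff 0 = 1 := by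
    rw [hSdef, HermiteAppell.coeff_symbol, if_pos (Nat.succ_pos K), hγ0]
  have hS : S.coeff 0 ≠ 0 := by rw [hS1]; exact one_ne_zero
  have hSN : HermiteAppell.nonRealZeroCount S = N :=
    (HermiteAppell.nonRealZeroCount_symbol hγ0).trans hN
  have hle : ∀ n, HermiteAppell.nonRealZeroCount (HermiteAppell.appell S n) ≤ N := fun n =>
    hSN ▸ HermiteAppell.nonRealZeroCount_appell_le S hS n
  have hmono := HermiteAppell.nonRealZeroCount_appell_mono S
  obtain ⟨M, hM⟩ : ∃ M, HermiteAppell.nonRealZeroCount (HermiteAppell.appell S M) = N := by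
    obtain ⟨M, hM⟩ := (HermiteAppell.eventually_nonRealZeroCount_le_appell hS1).exists
    exact ⟨M, le_antisymm (hle M) (hSN ▸ hM)⟩
  have hup : ∀ n m, HermiteAppell.nonRealZeroCount (HermiteAppell.appell S n) = N → n ≤ m →
      HermiteAppell.nonRealZeroCount (HermiteAppell.appell S m) = N := fun n m hn hnm =>
    le_antisymm (hle m) (hn ▸ hmono hnm)
  have hsimple : ∀ n, HermiteAppell.nonRealZeroCount (HermiteAppell.appell S n) = N →
      HermiteAppell.SimpleRealZeros (HermiteAppell.appell S n) := fun n hn =>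
    HermiteAppell.simpleRealZeros_appell hS fun m hm => (hup n m hn hm).trans hn.symm
  have hmain : ∀ n, HermiteAppell.nonRealZeroCount (HermiteAppell.appell S n) = N →
      HermiteAppell.SimpleRealZeros (HermiteAppell.appell S n) ∧
      HermiteAppell.Interlaces (HermiteAppell.realZeros (HermiteAppell.appell S (n + 1)))
        (HermiteAppell.realZeros (HermiteAppell.appell S n)) := fun n hn =>
    have hn1 := hup n (n + 1) hn n.le_succ
    ⟨hsimple n hn, HermiteAppell.interlaces_appell hS (hn1.trans hn.symm) (hsimple (n + 1) hn1)⟩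
  simp only [HermiteAppell.q_eq_appell, ← hSdef]
  refine ⟨?_, fun hN0 n => hmain n ?_, fun _ => ?_⟩
  · simp only [HermiteAppell.onlyRealZeros_iff (HermiteAppell.appell_ne_zero hS _)]
    refine ⟨fun h => hM ▸ h M, fun h n => ?_⟩
    have := hle n
    omega
  · have := hle n
    omega
  · have hex : ∃ n, HermiteAppell.nonRealZeroCount (HermiteAppell.appell S n) = N := ⟨M, hM⟩
    classical
    have hfind := Nat.find_spec hex
    refine ⟨Nat.find hex, ⟨hfind, fun n hn => Nat.find_min' hex hn⟩, fun n => ?_,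
      fun n hn => hmain n (hup _ n hfind hn)⟩
    refine ⟨fun h => Nat.find_min' hex h.2, fun hn => ?_⟩
    have h1 := hup _ n hfind hn
    have h2 := HermiteAppell.realZeroCount_add_nonRealZeroCount (HermiteAppell.appell S n)
    rw [HermiteAppell.natDegree_appell hS] at h2
    exact ⟨by omega, h1⟩
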